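/- Let $X$ be a real Banach space with the Radon–Nikodym property, that is: for every non-empty closed convex bounded set $C\subset X$ and every $\eta>0$ there are $g$ in the unit sphere $S_{X^*}$ of the dual and $c\in\mathbb{R}$ such that $\{x\in C:\ g(x)<c\}$ is non-empty and has diameter less than $\eta$. Let $f\in S_{X^*}$ and $\varepsilon\in(0,1)$, and let $B(f,\varepsilon)=\{g\in X^*:\ \|g-f\|<\varepsilon\}$. Then there is a map $t:X\to S_{X^*}\cap B(f,\varepsilon)$ such that every sequence $(x_n)_{n\in\mathbb{N}}$ in $X$ for which $\bigl(f(x_n)-\varepsilon\|x_n\|\bigr)_n$ is bounded below and $\langle t(x_n),x_{n+1}-x_n\rangle\le 0$ for all $n\in\mathbb{N}$ converges in $X$. In game language: for $m\in\mathbb{R}$, consider the game in which player B first chooses a point $x_0$ of the cone $K_m=\{x\in X:\ f(x)-\varepsilon\|x\|+m\ge 0\}$; once B has played $x_n$, player A chooses $f_n\in S_{X^*}\cap B(f,\varepsilon)$, and then B chooses $x_{n+1}\in K_m$ with $f_n(x_{n+1}-x_n)\le 0$; A wins if $(x_n)$ converges. Then the same map $t$ is, for every $m\in\mathbb{R}$,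 a winning tactic for A: A wins every play in which $f_n=t(x_n)$ for all $n$. -/

import Mathlib

open Filter Topology

/-- A real normed space `X` has the Radon-Nikodym property if every non-empty closed convex bounded
subset of `X` has non-empty open slices, cut by norm-one functionals, of arbitrarily small
diameter. -/
def HasRadonNikodymProperty (X : Type*) [NormedAddCommGroup X] [NormedSpace ℝ X] : Prop :=
  ∀ C : Set X, C.Nonempty → IsClosed C → Convex ℝ C → Bornology.IsBounded C →
    ∀ η : ℝ, 0 < η →
      ∃ g : StrongDual ℝ X, ‖g‖ = 1 ∧ ∃ c : ℝ,
        {x ∈ C | g x < c}.Nonempty ∧ Metric.diam {x ∈ C | g x < c} < η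

section PointSliceGame

variable {X : Type*} [NormedAddCommGroup X] [NormedSpace ℝ X]

/-- The moves allowed to player A: norm-one functionals at distance less than `ε` from `f`. -/
def AllowedFunctionals (f : StrongDual ℝ X) (ε : ℝ) : Set (StrongDual ℝ X) :=
  Metric.sphere 0 1 ∩ Metric.ball f ε

/-- The cone `{x | f x - ε ‖x‖ + m ≥ 0}`, in which player B chooses points. -/
def PointCone (f : StrongDual ℝ X) (ε m : ℝ) : Set X :=
  {x | 0 ≤ f x - ε * ‖x‖ + m}

/-- An infinite play of the point-slice game on the cone `PointCone f ε m`: player B plays the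
points `x n` and player A the functionals `F n`, in the order `x 0, F 0, x 1, F 1, …`, and B has to
choose `x (n + 1)` in the half space `{y | F n (y - x n) ≤ 0}`. -/
structure IsPlay (f : StrongDual ℝ X) (ε m : ℝ) (x : ℕ → X) (F : ℕ → StrongDual ℝ X) : Prop where
  point_mem : ∀ n, x n ∈ PointCone f ε m
  functional_mem : ∀ n, F n ∈ AllowedFunctionals f ε
  rule : ∀ n, F n (x (n + 1) - x n) ≤ 0

/-- Player A wins a play if the sequence of points converges in `X`. A winning tactic is a map `t`
from points to allowed functionals such that A wins every play in which A answers each point `x n`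
by `t (x n)`. -/
def IsWinningTactic (f : StrongDual ℝ X) (ε m : ℝ) (t : X → StrongDual ℝ X) : Prop :=
  (∀ x, t x ∈ AllowedFunctionals f ε) ∧
    ∀ (x : ℕ → X) (F : ℕ → StrongDual ℝ X), IsPlay f ε m x F → (∀ n, F n = t (x n)) →
      ∃ l : X, Tendsto x atTop (𝓝 l)

end PointSliceGame

/-! The space is cut into differences of consecutive cones, and each difference into slices of
diameter below 1, each of these into slices of diameter below 1/2, and so on. At each stage, slices
are removed transfinitely from a closed convex set until only its `lower` part remains, and a point
is ranked by the ordinal at which it is removed. Tolerances shrink so fast that the functionals of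
the nested pieces around `x` converge, and the limit `t x` stays within the tolerance of each of
them. A move `y` with `t x (y - x) ≤ 0` therefore cannot enter the set left after the removal of the
piece of `x`: within a stable piece the rank never increases, so it is eventually constant. The
integer level of the cone never decreases and is bounded, so it stabilizes too. By induction over
the stages the sequence ends up in one piece of each diameter bound, hence is Cauchy.

The sets being sliced may be unbounded, and the slicing functional must lie close to a prescribed
one. `HasRadonNikodymProperty.exists_small_slice` provides this by applying the Radon-Nikodym
property to the bounded set of minimizers of nearby functionals, which Bishop-Phelps
(`exists_isMinOn_near`) makes rich enough. `SliceNode.IsValid.exists_refinement` adds the tolerance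
that blocks moves into `lower`. -/

/-! ### Ekeland's principle and the Bishop-Phelps theorem -/

section BishopPhelps

variable {X : Type*} [NormedAddCommGroup X] [NormedSpace ℝ X]

/-- Ekeland's variational principle for a continuous linear functional on a closed set. -/
theorem exists_ekeland_point [CompleteSpace X] {D : Set X} (hD : IsClosed D)
    (g : StrongDual ℝ X) {τ σ : ℝ} (hτ : 0 < τ) {x : X} (hx : x ∈ D)
    (hmin : ∀ y ∈ D, g x ≤ g y + τ * σ) :
    ∃ z ∈ D, dist x z ≤ σ ∧ ∀ y ∈ D, g z ≤ g y + τ * dist y z := by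
  let S : X → Set X := fun u => {y ∈ D | g y + τ * dist y u ≤ g u}
  have hbdd : ∀ u, BddBelow (g '' S u) := by
    rintro u
    refine ⟨g x - τ * σ, ?_⟩
    rintro _ ⟨y, hy, rfl⟩
    linarith [hmin y hy.1]
  have hself : ∀ u ∈ D, u ∈ S u := fun u hu => ⟨hu, by simp⟩
  have hnext : ∀ (n : ℕ) (u : D), ∃ v : D, (v : X) ∈ S u ∧
      ∀ y ∈ S u, g v ≤ g y + (1 / 2) ^ n := by
    intro n u
    have hne : (g '' S u).Nonempty := ⟨_, u, hself u u.2, rfl⟩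
    obtain ⟨_, ⟨v, hv, rfl⟩, hlt⟩ := exists_lt_of_csInf_lt hne
      (lt_add_of_pos_right (sInf (g '' S u)) (by positivity : (0 : ℝ) < (1 / 2) ^ n))
    refine ⟨⟨v, hv.1⟩, hv, fun y hy => ?_⟩
    have := csInf_le (hbdd u) ⟨y, hy, rfl⟩
    simp only
    linarith
  choose F hFS hFmin using hnext
  let w : ℕ → D := fun n => Nat.rec ⟨x, hx⟩ (fun k u => F k u) n
  have htrans : ∀ {a b c : X}, b ∈ S a → c ∈ S b → c ∈ S a := by
    intro a b c hb hc
    refine ⟨hc.1, ?_⟩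
    have h1 := hb.2
    have h2 := hc.2
    have h3 := mul_le_mul_of_nonneg_left (dist_triangle c b a) hτ.le
    linarith
  have hw : ∀ n k : ℕ, (w (n + k)).1 ∈ S (w n).1 := by
    intro n k
    induction k with
    | zero => exact hself _ (w n).2
    | succ k ih => exact htrans ih (hFS (n + k) (w (n + k)))
  -- Such a `y` also competes in `S (w n)`, where `w (n + 1)` is minimal up to `(1 / 2) ^ n`; hence
  -- these sets shrink to a point.
  have hclose : ∀ n, ∀ y ∈ S (w (n + 1)), τ * dist y (w (n + 1)) ≤ (1 / 2) ^ n := by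
    intro n y hy
    have h1 := hFmin n (w n) y (htrans (hFS n (w n)) hy)
    have h2 := hy.2
    change g (w (n + 1)) ≤ _ at h1
    linarith
  have hcauchy : CauchySeq fun n => (w (n + 1) : X) := by
    refine cauchySeq_of_le_geometric (1 / 2) (1 / τ) (by norm_num) fun n => ?_
    have := hclose n _ (hw (n + 1) 1)
    rw [dist_comm, one_div_mul_eq_div, le_div_iff₀ hτ]
    linarith
  obtain ⟨z, hz⟩ := cauchySeq_tendsto_of_complete hcauchy
  have hScl : ∀ u, IsClosed (S u) := fun u =>
    hD.inter (isClosed_le (f := fun y => g y + τ * dist y u) (by fun_prop) continuous_const)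
  have hzS : ∀ n, z ∈ S (w n).1 := by
    intro n
    refine (hScl _).mem_of_tendsto hz (eventually_atTop.2 ⟨n, fun k hk => ?_⟩)
    have := hw n (k + 1 - n)
    rwa [show n + (k + 1 - n) = k + 1 by omega] at this
  refine ⟨z, (hzS 0).1, ?_, fun y hy => ?_⟩
  · have h1 := (hzS 0).2
    have h2 := hmin z (hzS 0).1
    change g z + τ * dist z x ≤ g x at h1
    rw [dist_comm]
    exact le_of_mul_le_mul_left (by linarith) hτ
  · by_contra! hlt
    have hyz : y ∈ S z := ⟨hy, hlt.le⟩
    have hlim : Tendsto (fun n => (w (n + 1) : X)) atTop (𝓝 y) := by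
      rw [tendsto_iff_dist_tendsto_zero]
      refine squeeze_zero (fun _ => dist_nonneg) (g := fun n => 1 / τ * (1 / 2) ^ n) (fun n => ?_) ?_
      · have := hclose n y (htrans (hzS (n + 1)) hyz)
        rw [dist_comm, one_div_mul_eq_div, le_div_iff₀ hτ]
        linarith
      · simpa using (tendsto_pow_atTop_nhds_zero_of_lt_one (r := (1 / 2 : ℝ))
          (by norm_num) (by norm_num)).const_mul (1 / τ)
    have := tendsto_nhds_unique hlim hz
    subst this
    simp at hlt

/-- A functional that decreases on a convex set at a rate at most `τ` from a point `z` is turned by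
a perturbation of norm at most `τ` into one which attains its minimum at `z`. -/
theorem exists_perturbation_isMinOn {D : Set X} (hD : Convex ℝ D) (g : StrongDual ℝ X)
    {τ : ℝ} (hτ : 0 < τ) {z : X} (hz : z ∈ D) (hmin : ∀ y ∈ D, g z ≤ g y + τ * dist y z) :
    ∃ k : StrongDual ℝ X, ‖k‖ ≤ τ ∧ IsMinOn (g + k) D z := by
  -- The hypothesis says exactly that the open cone `A` misses the hypograph `B` of `-g` over `D -
  -- z`. A separating hyperplane is the graph of the required perturbation `ψ`.
  let A : Set (X × ℝ) := {p | τ * ‖p.1‖ < p.2}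
  let B : Set (X × ℝ) := {p | p.1 + z ∈ D ∧ p.2 ≤ -g p.1}
  have hAconv : Convex ℝ A := by
    rintro ⟨a, s⟩ ha ⟨b, t⟩ hb p q hp hq hpq
    simp only [A, Set.mem_ofPred_eq, Prod.smul_mk, Prod.mk_add_mk, smul_eq_mul] at *
    have h1 : ‖p • a + q • b‖ ≤ p * ‖a‖ + q * ‖b‖ := by
      refine (norm_add_le _ _).trans_eq ?_
      rw [norm_smul, norm_smul, Real.norm_of_nonneg hp, Real.norm_of_nonneg hq]
    have h2 := mul_le_mul_of_nonneg_left h1 hτ.le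
    rcases hp.eq_or_lt with rfl | hp
    · obtain rfl : q = 1 := by linarith
      linarith
    · have h3 := mul_lt_mul_of_pos_left ha hp
      have h4 := mul_le_mul_of_nonneg_left hb.le hq
      linarith
  have hAopen : IsOpen A := isOpen_lt (by fun_prop) (by fun_prop)
  have hBconv : Convex ℝ B := by
    rintro ⟨a, s⟩ ⟨ha, hs⟩ ⟨b, t⟩ ⟨hb, ht⟩ p q hp hq hpq
    refine ⟨?_, ?_⟩
    · have := hD ha hb hp hq hpq
      convert this using 1
      simp only [Prod.smul_mk, Prod.mk_add_mk, smul_add]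
      nth_rewrite 1 [← one_smul ℝ z]
      rw [← hpq, add_smul]
      abel
    · simp only [Prod.smul_mk, Prod.mk_add_mk, smul_eq_mul, map_add, map_smul] at *
      nlinarith [mul_le_mul_of_nonneg_left hs hp, mul_le_mul_of_nonneg_left ht hq]
  have hdisj : Disjoint A B := by
    rw [Set.disjoint_left]
    rintro ⟨a, s⟩ ha ⟨hb, hs⟩
    have := hmin _ hb
    simp only [A, Set.mem_ofPred_eq, map_add, dist_eq_norm, add_sub_cancel_right] at *
    linarith
  obtain ⟨φ, u, hφA, hφB⟩ := geometric_hahn_banach_open hAconv hAopen hBconv hdisj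
  have hu0 : u ≤ 0 := by
    have := hφB (0, 0) ⟨by simpa using hz, by simp⟩
    rwa [Prod.mk_zero_zero, map_zero] at this
  set β : ℝ := φ (0, 1) with hβdef
  have hdecomp : ∀ (a : X) (s : ℝ), φ (a, s) = φ (a, 0) + s * β := by
    intro a s
    rw [hβdef, ← smul_eq_mul, ← map_smul, ← map_add]
    simp
  have hβ : β < 0 := by
    have := hφA (0, 1) (by simp [A])
    linarith
  let ψ : StrongDual ℝ X := (-β)⁻¹ • φ.comp (ContinuousLinearMap.inl ℝ X ℝ)
  have hβ' : β ≠ 0 := hβ.ne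
  have hψ : ∀ a, φ (a, 0) = -β * ψ a := by
    intro a
    simp only [ψ, smul_apply, ContinuousLinearMap.comp_apply,
      ContinuousLinearMap.inl_apply, smul_eq_mul]
    field_simp
  have hψle : ∀ a, ψ a ≤ τ * ‖a‖ := by
    intro a
    refine le_of_forall_pos_lt_add fun s hs => ?_
    have h1 := hφA (a, τ * ‖a‖ + s) (by simp [A, hs])
    rw [hdecomp, hψ] at h1
    have h2 : -β * ψ a < -β * (τ * ‖a‖ + s) := by linarith
    exact lt_of_mul_lt_mul_left h2 (by linarith)
  refine ⟨ψ, ψ.opNorm_le_bound hτ.le fun a => ?_, fun y hy => ?_⟩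
  · rw [Real.norm_eq_abs, abs_le]
    refine ⟨?_, hψle a⟩
    have := hψle (-a)
    rw [map_neg, norm_neg] at this
    linarith
  · have hu : 0 ≤ u := by
      refine le_of_forall_pos_lt_add fun s hs => ?_
      have h1 := hφA (0, s / -β) (by simpa [A] using div_pos hs (by linarith))
      rw [hdecomp, hψ, map_zero] at h1
      have h2 : s / -β * β = -s := by field_simp
      linarith
    have h1 := hφB (y - z, -g (y - z)) ⟨by simpa using hy, le_rfl⟩
    rw [hdecomp, hψ] at h1
    have h2 : 0 ≤ -β * (ψ (y - z) + g (y - z)) := by linarith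
    have h3 := nonneg_of_mul_nonneg_right h2 (by linarith)
    simp only [Set.mem_ofPred_eq, add_apply, map_sub] at *
    linarith

/-- The Bishop-Phelps theorem for the minimization of a functional on a closed convex set. -/
theorem exists_isMinOn_near [CompleteSpace X] {D : Set X} (hD : IsClosed D) (hconv : Convex ℝ D)
    (g : StrongDual ℝ X) {τ σ : ℝ} (hτ : 0 < τ) {x : X} (hx : x ∈ D)
    (hmin : ∀ y ∈ D, g x ≤ g y + τ * σ) :
    ∃ z ∈ D, dist x z ≤ σ ∧ ∃ k : StrongDual ℝ X, ‖k‖ ≤ τ ∧ IsMinOn (g + k) D z := by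
  obtain ⟨z, hz, hxz, hzmin⟩ := exists_ekeland_point hD g hτ hx hmin
  exact ⟨z, hz, hxz, exists_perturbation_isMinOn hconv g hτ hz hzmin⟩

end BishopPhelps

/-! ### Small slices of unbounded closed convex sets -/

section SmallSlices

variable {X : Type*} [NormedAddCommGroup X] [NormedSpace ℝ X]

theorem StrongDual.le_add_of_norm_sub_le {g h : StrongDual ℝ X} {r : ℝ} (hgh : ‖g - h‖ ≤ r)
    (x : X) : g x ≤ h x + r * ‖x‖ := by
  have h1 := (le_abs_self _).trans ((g - h).le_of_opNorm_le hgh x)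
  rw [sub_apply] at h1
  linarith

/-- In a Banach space with the Radon-Nikodym property, the functionals that cut slices of small
diameter from a closed convex set are dense near a functional that is coercive on this set. -/
theorem HasRadonNikodymProperty.exists_small_slice [CompleteSpace X]
    (hX : HasRadonNikodymProperty X) {D : Set X} (hD : IsClosed D) (hconv : Convex ℝ D)
    (hne : D.Nonempty) {g : StrongDual ℝ X} {κ b : ℝ} (hκ : 0 < κ)
    (hcoer : ∀ x ∈ D, κ * ‖x‖ - b ≤ g x) {η δ : ℝ} (hη : 0 < η) (hδ : 0 < δ) :
    ∃ (g' : StrongDual ℝ X) (c : ℝ), ‖g' - g‖ ≤ δ ∧ {x ∈ D | g' x < c}.Nonempty ∧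
      ∀ x ∈ D, ∀ y ∈ D, g' x < c → g' y < c → dist x y < η := by
  -- Then all functionals within `δ` of `g` are coercive on `D` with constant `κ / 2`, so their
  -- minimizers are uniformly bounded.
  wlog hδκ : δ ≤ κ / 2 generalizing δ
  · obtain ⟨g', c, h1, h2⟩ := this (δ := κ / 2) (by linarith) le_rfl
    exact ⟨g', c, h1.trans (by linarith), h2⟩
  have hlow : ∀ k : StrongDual ℝ X, ‖k - g‖ ≤ δ → ∀ x ∈ D, κ / 2 * ‖x‖ - b ≤ k x := by
    intro k hk x hx
    have h1 := StrongDual.le_add_of_norm_sub_le ((norm_sub_rev g k).trans_le hk) x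
    have h2 := hcoer x hx
    have h3 := mul_le_mul_of_nonneg_right hδκ (norm_nonneg x)
    linarith
  have hbdd : ∀ k : StrongDual ℝ X, ‖k - g‖ ≤ δ → BddBelow (k '' D) := by
    intro k hk
    refine ⟨-b, ?_⟩
    rintro _ ⟨x, hx, rfl⟩
    have h1 := hlow k hk x hx
    have h2 : 0 ≤ κ / 2 * ‖x‖ := by positivity
    linarith
  have hnear : ∀ k : StrongDual ℝ X, ‖k - g‖ ≤ δ → ∀ s : ℝ, 0 < s →
      ∃ c, {x ∈ D | k x < c}.Nonempty ∧ ∀ x, k x < c → ∀ y ∈ D, k x ≤ k y + s := by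
    intro k hk s hs
    refine ⟨sInf (k '' D) + s, ?_, fun x hx y hy => ?_⟩
    · obtain ⟨_, ⟨v, hv, rfl⟩, hlt⟩ := exists_lt_of_csInf_lt (hne.image k)
        (lt_add_of_pos_right (sInf (k '' D)) hs)
      exact ⟨v, hv, hlt⟩
    · have := csInf_le (hbdd k hk) ⟨y, hy, rfl⟩
      linarith
  let E : Set X := {x ∈ D | ∃ k : StrongDual ℝ X, ‖k - g‖ < δ ∧ IsMinOn k D x}
  have hEne : E.Nonempty := by
    obtain ⟨c, ⟨x, hx, hxc⟩, hc⟩ := hnear g (by simpa using hδ.le) (δ / 2 * 1) (by positivity)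
    obtain ⟨z, hz, -, k, hk, hmin⟩ :=
      exists_isMinOn_near hD hconv g (by positivity) hx (hc x hxc)
    exact ⟨z, hz, g + k, by simpa using hk.trans_lt (by linarith), hmin⟩
  obtain ⟨w, hw⟩ := hne
  obtain ⟨R, hR0, hR⟩ : ∃ R : ℝ, 0 < R ∧ ∀ x ∈ E, ‖x‖ ≤ R := by
    refine ⟨max 1 ((g w + δ * ‖w‖ + b) / (κ / 2)), by positivity, ?_⟩
    rintro x ⟨hx, k, hk, hmin⟩
    have h1 : k x ≤ k w := hmin hw
    have h2 := StrongDual.le_add_of_norm_sub_le hk.le w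
    have h3 := hlow k hk.le x hx
    refine le_max_of_le_right ?_
    rw [le_div_iff₀ (by positivity)]
    linarith
  have hEbdd : Bornology.IsBounded E := isBounded_iff_forall_norm_le.2 ⟨R, hR⟩
  obtain ⟨h, hh, c, ⟨p, hpC, hpc⟩, hdiam⟩ := hX (closedConvexHull ℝ E)
    (hEne.mono subset_closedConvexHull) isClosed_closedConvexHull convex_closedConvexHull
    (by rw [closedConvexHull_eq_closure_convexHull]
        exact (isBounded_convexHull.2 hEbdd).closure)
    (η / 2) (by positivity)
  obtain ⟨x₀, hx₀E, hx₀c⟩ : ∃ x ∈ E, h x < c := by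
    by_contra! hcon
    have : closedConvexHull ℝ E ⊆ {x | c ≤ h x} :=
      closedConvexHull_min hcon (convex_halfSpace_ge h.toLinearMap.isLinear c)
        (isClosed_le continuous_const h.continuous)
    exact absurd (this hpC) (not_le.2 hpc)
  have hslice : ∀ x ∈ E, ∀ y ∈ E, h x < c → h y < c → dist x y < η / 2 := by
    intro x hx y hy hxc hyc
    refine (Metric.dist_le_diam_of_mem ?_ ?_ ?_).trans_lt hdiam
    · refine Bornology.IsBounded.subset ?_ (Set.sep_subset _ _)
      rw [closedConvexHull_eq_closure_convexHull]
      exact (isBounded_convexHull.2 hEbdd).closure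
    · exact ⟨subset_closedConvexHull hx, hxc⟩
    · exact ⟨subset_closedConvexHull hy, hyc⟩
  obtain ⟨hx₀D, g₀, hg₀, hmin₀⟩ := id hx₀E
  -- Tilting `g₀` by `r • h` pushes minimizers into the slice `h < c`. The factor 3 leaves room for
  -- a further perturbation of norm at most `τ ≤ r`, and `τ * (2 * R)` bounds its variation on `E`.
  set r : ℝ := (δ - ‖g₀ - g‖) / 3 with hr
  have hr0 : 0 < r := by rw [hr]; linarith
  obtain ⟨τ, hτ0, hτr, hτ⟩ : ∃ τ : ℝ, 0 < τ ∧ τ ≤ r ∧ τ * (2 * R) < r * (c - h x₀) := by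
    have hpos : 0 < r * (c - h x₀) := mul_pos hr0 (by linarith)
    refine ⟨min r (r * (c - h x₀) / (4 * R)), by positivity, min_le_left _ _, ?_⟩
    calc min r (r * (c - h x₀) / (4 * R)) * (2 * R)
        ≤ r * (c - h x₀) / (4 * R) * (2 * R) := by gcongr; exact min_le_right _ _
      _ = r * (c - h x₀) / 2 := by field_simp; norm_num
      _ < _ := by linarith
  have hrh : ‖r • h‖ = r := by rw [norm_smul, hh, Real.norm_of_nonneg hr0.le, mul_one]
  have hg₁ : ‖g₀ + r • h - g‖ ≤ δ - 2 * r := by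
    calc ‖g₀ + r • h - g‖ = ‖(g₀ - g) + r • h‖ := by congr 1; abel
      _ ≤ ‖g₀ - g‖ + ‖r • h‖ := norm_add_le _ _
      _ = δ - 2 * r := by rw [hrh, hr]; ring
  obtain ⟨c', hne', hc'⟩ := hnear (g₀ + r • h) (hg₁.trans (by linarith)) (τ * (η / 8)) (by positivity)
  have happrox : ∀ x ∈ D, (g₀ + r • h) x < c' → ∃ z ∈ E, h z < c ∧ dist x z ≤ η / 8 := by
    intro x hx hxc
    obtain ⟨z, hz, hxz, k, hk, hmin⟩ := exists_isMinOn_near hD hconv _ hτ0 hx (hc' x hxc)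
    have hzE : z ∈ E := by
      refine ⟨hz, _, ?_, hmin⟩
      calc ‖g₀ + r • h + k - g‖ = ‖(g₀ + r • h - g) + k‖ := by congr 1; abel
        _ ≤ ‖g₀ + r • h - g‖ + ‖k‖ := norm_add_le _ _
        _ < δ := by linarith
    -- Compare `z` with `x₀`: since `x₀` minimizes `g₀`, minimality of `z` forces `r * h z ≤ r * h
    -- x₀ + k (x₀ - z)`, which is less than `r * c`.
    refine ⟨z, hzE, ?_, hxz⟩
    have h1 : (g₀ + r • h + k) z ≤ (g₀ + r • h + k) x₀ := hmin hx₀D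
    have h2 : g₀ x₀ ≤ g₀ z := hmin₀ hz
    have h3 : k x₀ - k z ≤ τ * (2 * R) := by
      rw [← map_sub]
      refine (le_abs_self _).trans ((k.le_of_opNorm_le hk _).trans ?_)
      have := norm_sub_le x₀ z
      gcongr
      linarith [hR _ hx₀E, hR _ hzE]
    simp only [add_apply, smul_apply, smul_eq_mul] at h1
    have h4 : r * h z < r * c := by linarith
    exact lt_of_mul_lt_mul_left h4 hr0.le
  refine ⟨g₀ + r • h, c', hg₁.trans (by linarith), hne', fun x hx y hy hxc hyc => ?_⟩
  obtain ⟨u, hu, huc, hxu⟩ := happrox x hx hxc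
  obtain ⟨v, hv, hvc, hyv⟩ := happrox y hy hyc
  have h1 := hslice u hu v hv huc hvc
  have h2 := dist_triangle4_right x y u v
  have h3 := dist_triangle4 x u v y
  rw [dist_comm v y] at h3
  linarith

end SmallSlices

/-! ### Transfinite removal -/

section TransfiniteRemoval

universe u

/-- The transfinite sequence of sets obtained from `K` by iterating `s` and taking
intersections at limit steps. -/
noncomputable def iterRemoval {X : Type u} (K : Set X) (s : Set X → Set X) :
    Ordinal.{u} → Set X :=
  WellFounded.fix Ordinal.lt_wf fun α F => K ∩ ⋂ (β : Ordinal.{u}) (h : β < α), s (F β h)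

variable {X : Type u} {K : Set X} {s : Set X → Set X}

theorem iterRemoval_eq (α : Ordinal.{u}) :
    iterRemoval K s α = K ∩ ⋂ (β : Ordinal.{u}) (_ : β < α), s (iterRemoval K s β) := by
  rw [iterRemoval, WellFounded.fix_eq]

theorem mem_iterRemoval {α : Ordinal.{u}} {x : X} :
    x ∈ iterRemoval K s α ↔ x ∈ K ∧ ∀ β < α, x ∈ s (iterRemoval K s β) := by
  rw [iterRemoval_eq]
  simp

/-- If a class `P` of subsets of `K` is closed under intersections and if `s` shrinks every set of
the class other than its smallest element `L`, then each point outside `L` is removed by `s` at some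
stage of the transfinite iteration. -/
theorem exists_mem_iterRemoval_diff {L : Set X} {P : Set X → Prop}
    (hinter : ∀ (ι : Type (u + 1)) (F : ι → Set X), (∀ i, P (F i)) → P (K ∩ ⋂ i, F i))
    (hs : ∀ D, P D → P (s D) ∧ s D ⊆ D ∧ (s D = D → D = L)) :
    (∀ α, P (iterRemoval K s α)) ∧ ∀ x ∈ K \ L, ∃ α, x ∈ iterRemoval K s α \ s (iterRemoval K s α) := by
  have hP : ∀ α, P (iterRemoval K s α) := by
    intro α
    induction α using WellFoundedLT.induction with
    | ind α ih =>
      have := hinter (Set.Iio α) (fun β => s (iterRemoval K s β)) fun β => (hs _ (ih β β.2)).1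
      rw [iterRemoval_eq]
      convert this using 2
      ext x
      simp
  refine ⟨hP, fun x hx => ?_⟩
  have hne : ∃ β, x ∉ s (iterRemoval K s β) := by
    by_contra! hcon
    have hxmem : ∀ α, x ∈ iterRemoval K s α := fun α => mem_iterRemoval.2 ⟨hx.1, fun β _ => hcon β⟩
    -- A point outside `L` that is never removed would make all stages distinct, embedding the
    -- ordinals into `Set X`: two equal stages force a fixed point of `s`, that is, `L`.
    refine not_injective_of_ordinal (iterRemoval K s) fun α β hαβ => ?_
    by_contra hne
    wlog hlt : α < β generalizing α β
    · exact this β α hαβ.symm (Ne.symm hne) (lt_of_le_of_ne (not_lt.1 hlt) (Ne.symm hne))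
    have hsub : iterRemoval K s β ⊆ s (iterRemoval K s α) :=
      fun y hy => (mem_iterRemoval.1 hy).2 α hlt
    have heq := (hs _ (hP α)).2.2 ((hs _ (hP α)).2.1.antisymm (hαβ ▸ hsub))
    exact hx.2 (heq ▸ hxmem α)
  obtain ⟨α, hα, hmin⟩ := WellFounded.has_min Ordinal.lt_wf {β | x ∉ s (iterRemoval K s β)} hne
  refine ⟨α, mem_iterRemoval.2 ⟨hx.1, fun β hβ => ?_⟩, hα⟩
  by_contra hcon
  exact hmin β hcon hβ

/-- Points of the transfinite removal are ranked by the stage of their removal. -/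
theorem exists_removal_rank {L : Set X} {P : Set X → Prop}
    (hinter : ∀ (ι : Type (u + 1)) (F : ι → Set X), (∀ i, P (F i)) → P (K ∩ ⋂ i, F i))
    (hs : ∀ D, P D → P (s D) ∧ s D ⊆ D ∧ (s D = D → D = L)) :
    ∃ (ρ : X → Ordinal.{u}) (Φ : Ordinal.{u} → Set X), (∀ α, P (Φ α)) ∧
      (∀ x ∈ K \ L, x ∈ Φ (ρ x) \ s (Φ (ρ x))) ∧
      ∀ x, ∀ y ∈ K \ L, ρ x < ρ y → y ∈ s (Φ (ρ x)) := by
  obtain ⟨hP, hex⟩ := exists_mem_iterRemoval_diff hinter hs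
  choose! ρ hρ using hex
  exact ⟨ρ, iterRemoval K s, hP, hρ, fun x y hy hlt => (mem_iterRemoval.1 (hρ y hy).1).2 _ hlt⟩

end TransfiniteRemoval

/-! ### Slices with tolerances and their refinements -/

section SliceNodes

/-- A difference `upper \ lower` of closed convex sets, together with a functional and
a tolerance for perturbations of this functional. -/
structure SliceNode (X : Type*) [NormedAddCommGroup X] [NormedSpace ℝ X] where
  upper : Set X
  lower : Set X
  functional : StrongDual ℝ X
  tol : ℝ

variable {X : Type*} [NormedAddCommGroup X] [NormedSpace ℝ X]

/-- The functional of the node is coercive on the upper set, and functionals within the tolerance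
separate the points of the upper set from the lower set. -/
structure SliceNode.IsValid (N : SliceNode X) : Prop where
  tol_pos : 0 < N.tol
  lower_subset : N.lower ⊆ N.upper
  isClosed_upper : IsClosed N.upper
  convex_upper : Convex ℝ N.upper
  isClosed_lower : IsClosed N.lower
  convex_lower : Convex ℝ N.lower
  coercive : ∃ b : ℝ, ∀ x ∈ N.upper, N.tol * ‖x‖ - b ≤ N.functional x
  separated : ∀ x ∈ N.upper \ N.lower, ∃ (g : StrongDual ℝ X) (c : ℝ),
    ‖g - N.functional‖ < N.tol ∧ g x < c ∧ ∀ y ∈ N.lower, c ≤ g y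

/-- `N'` is a small part of `N`, and functionals within the tolerance of `N'` do not allow to move
from this part into the lower set of `N`. -/
structure SliceNode.IsRefinement (N' N : SliceNode X) (η : ℝ) : Prop where
  isValid : N'.IsValid
  norm_sub_add_tol_le : ‖N'.functional - N.functional‖ + N'.tol ≤ N.tol
  tol_le_half : N'.tol ≤ N.tol / 2
  dist_lt : ∀ x ∈ N'.upper \ N'.lower, ∀ y ∈ N'.upper \ N'.lower, dist x y < η
  notMem_lower : ∀ x ∈ N'.upper \ N'.lower, ∀ t : StrongDual ℝ X, ‖t - N'.functional‖ ≤ N'.tol →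
    ∀ y ∈ N.upper, t (y - x) ≤ 0 → y ∉ N.lower

/-- The node formed by the slice of `D` cut by the half space `{x | g x < c}`. -/
def SliceNode.ofSlice (D : Set X) (g : StrongDual ℝ X) (c δ : ℝ) : SliceNode X where
  upper := D
  lower := {x ∈ D | c ≤ g x}
  functional := g
  tol := δ

theorem SliceNode.mem_ofSlice_diff {D : Set X} {g : StrongDual ℝ X} {c δ : ℝ} {x : X} :
    x ∈ (ofSlice D g c δ).upper \ (ofSlice D g c δ).lower ↔ x ∈ D ∧ g x < c := by
  simp only [ofSlice, Set.mem_sdiff, Set.mem_ofPred_eq, not_and, not_le]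
  tauto

/-- A functional `g` separating some `x₀ ∈ D` from `lower` leaves a gap `4 * γ`. Take a small slice
cut by `g'` near `g`, lowered to values below `g' x₀ + γ`. Coercivity bounds both ends of a move
from this slice into `lower`, so a small tolerance `θ` changes the values by less than `2 * γ` and
the gap cannot be crossed. -/
theorem SliceNode.IsValid.exists_refinement [CompleteSpace X] (hX : HasRadonNikodymProperty X)
    {N : SliceNode X} (hN : N.IsValid) {η : ℝ} (hη : 0 < η) {D : Set X} (hD : IsClosed D)
    (hconv : Convex ℝ D) (hLD : N.lower ⊆ D) (hDK : D ⊆ N.upper) (hne : D ≠ N.lower) :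
    ∃ (g' : StrongDual ℝ X) (c' δ' : ℝ), {x ∈ D | g' x < c'}.Nonempty ∧
      (SliceNode.ofSlice D g' c' δ').IsRefinement N η := by
  obtain ⟨x₀, hx₀, hx₀L⟩ : ∃ x ∈ D, x ∉ N.lower := by
    by_contra! hcon
    exact hne (Set.Subset.antisymm hcon hLD)
  obtain ⟨g, c, hg, hx₀c, hLc⟩ := hN.separated x₀ ⟨hDK hx₀, hx₀L⟩
  obtain ⟨b, hb⟩ := hN.coercive
  set κ : ℝ := N.tol - ‖g - N.functional‖ with hκ
  have hκ0 : 0 < κ := by rw [hκ]; linarith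
  have hcoer : ∀ x ∈ N.upper, κ * ‖x‖ - b ≤ g x := by
    intro x hx
    have h1 := StrongDual.le_add_of_norm_sub_le (norm_sub_rev N.functional g).le x
    have h2 := hb x hx
    have h3 : κ * ‖x‖ = N.tol * ‖x‖ - ‖g - N.functional‖ * ‖x‖ := by rw [hκ]; ring
    linarith
  set γ : ℝ := (c - g x₀) / 4 with hγ
  have hγ0 : 0 < γ := by rw [hγ]; linarith
  set B : ℝ := g x₀ + κ * ‖x₀‖ + γ + b with hB
  have hB0 : 0 ≤ B := by
    have h1 := hcoer x₀ (hDK hx₀)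
    have h2 : 0 ≤ κ * ‖x₀‖ := by positivity
    linarith
  -- The total error is `θ * (‖x₀‖ + ‖x‖ + 2 * ‖y‖)`, with `‖x‖` and `‖y‖` at most `4 * B / κ`.
  set R : ℝ := ‖x₀‖ + 12 * B / κ with hR
  have hR0 : 0 ≤ R := by positivity
  obtain ⟨θ, hθ0, hθκ, hθR⟩ : ∃ θ : ℝ, 0 < θ ∧ θ ≤ κ / 4 ∧ θ * R < 2 * γ := by
    refine ⟨min (κ / 4) (γ / (R + 1)), by positivity, min_le_left _ _, ?_⟩
    calc min (κ / 4) (γ / (R + 1)) * R ≤ γ / (R + 1) * (R + 1) := by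
          gcongr
          · exact min_le_right _ _
          · linarith
      _ = γ := by field_simp
      _ < 2 * γ := by linarith
  obtain ⟨g', c₀, hg', ⟨p, hp, hpc⟩, hsmall⟩ := hX.exists_small_slice hD hconv ⟨x₀, hx₀⟩ hκ0
    (fun x hx => hcoer x (hDK hx)) hη hθ0
  have hnorm : ‖g' - N.functional‖ + 2 * θ ≤ N.tol := by
    have h1 := norm_sub_le_norm_sub_add_norm_sub g' g N.functional
    linarith
  set c' : ℝ := min c₀ (g' x₀ + γ) with hc'
  have hmove : ∀ x ∈ D, g' x < c' → ∀ t : StrongDual ℝ X, ‖t - g'‖ ≤ θ →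
      ∀ y ∈ N.upper, t (y - x) ≤ 0 → y ∉ N.lower := by
    intro x hx hxc t ht y hy hyx hyL
    rw [map_sub] at hyx
    have h1 : g' x < g' x₀ + γ := hxc.trans_le (min_le_right _ _)
    have h2 := StrongDual.le_add_of_norm_sub_le ht x
    have h3 := StrongDual.le_add_of_norm_sub_le ((norm_sub_rev g' t).trans_le ht) y
    have h4 := StrongDual.le_add_of_norm_sub_le hg' x₀
    have h5 := StrongDual.le_add_of_norm_sub_le ((norm_sub_rev g g').trans_le hg') y
    have h6 := StrongDual.le_add_of_norm_sub_le ((norm_sub_rev g g').trans_le hg') x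
    have h7 := hcoer x (hDK hx)
    have h8 := hcoer y hy
    have h9 := hLc y hyL
    have hθx₀ := mul_le_mul_of_nonneg_right hθκ (norm_nonneg x₀)
    have hθx := mul_le_mul_of_nonneg_right hθκ (norm_nonneg x)
    have hθy := mul_le_mul_of_nonneg_right hθκ (norm_nonneg y)
    have hκx₀ : 0 ≤ κ * ‖x₀‖ := by positivity
    have hx : ‖x‖ ≤ 4 * B / κ := by
      rw [le_div_iff₀ hκ0]
      linarith
    have hy : ‖y‖ ≤ 4 * B / κ := by
      rw [le_div_iff₀ hκ0]
      linarith
    have h10 : θ * (‖x₀‖ + ‖x‖ + 2 * ‖y‖) ≤ θ * R := by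
      gcongr
      rw [hR, show 12 * B / κ = 4 * B / κ + 2 * (4 * B / κ) by ring]
      linarith
    linarith
  have hLc' : ∀ y ∈ N.lower, c' ≤ g' y := by
    intro y hy
    by_contra! hlt
    -- The trivial move from `y` to itself is already forbidden.
    exact hmove y (hLD hy) hlt g' (by simpa using hθ0.le) y (hN.lower_subset hy) (by simp) hy
  refine ⟨g', c', θ, ?_, ?_⟩
  · rcases lt_or_ge (g' x₀) c₀ with h | h
    · exact ⟨x₀, hx₀, lt_min h (by linarith)⟩
    · exact ⟨p, hp, lt_min hpc (by linarith)⟩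
  · refine ⟨⟨hθ0, Set.sep_subset _ _, hD, hconv, ?_, ?_, ⟨b, fun x hx => ?_⟩, fun x hx => ?_⟩,
      ?_, ?_, ?_, ?_⟩
    · exact hD.inter (isClosed_le continuous_const g'.continuous)
    · exact hconv.inter (convex_halfSpace_ge g'.toLinearMap.isLinear c')
    · change θ * ‖x‖ - b ≤ g' x
      have h1 := StrongDual.le_add_of_norm_sub_le ((norm_sub_rev g g').trans_le hg') x
      have h2 := hcoer x (hDK hx)
      have h3 := mul_le_mul_of_nonneg_right hθκ (norm_nonneg x)
      have h4 : 0 ≤ κ * ‖x‖ := by positivity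
      linarith
    · exact ⟨g', c', by simpa [SliceNode.ofSlice] using hθ0, (SliceNode.mem_ofSlice_diff.1 hx).2,
        fun y hy => hy.2⟩
    · change ‖g' - N.functional‖ + θ ≤ N.tol
      linarith
    · change θ ≤ N.tol / 2
      linarith [norm_nonneg (g - N.functional)]
    · intro x hx y hy
      rw [SliceNode.mem_ofSlice_diff] at hx hy
      exact hsmall x hx.1 y hy.1 (hx.2.trans_le (min_le_left _ _)) (hy.2.trans_le (min_le_left _ _))
    · intro x hx
      rw [SliceNode.mem_ofSlice_diff] at hx
      exact hmove x hx.1 hx.2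

/-- A valid node is split into small refinements, which are ranked by ordinals. -/
theorem SliceNode.IsValid.exists_rank {X : Type u} [NormedAddCommGroup X] [NormedSpace ℝ X]
    [CompleteSpace X] (hX : HasRadonNikodymProperty X)
    {N : SliceNode X} (hN : N.IsValid) {η : ℝ} (hη : 0 < η) :
    ∃ (ρ : X → Ordinal.{u}) (C : X → SliceNode X),
      (∀ x ∈ N.upper \ N.lower, (C x).IsRefinement N η ∧ x ∈ (C x).upper \ (C x).lower) ∧
      (∀ x y, ρ x = ρ y → C x = C y) ∧
      ∀ x ∈ N.upper \ N.lower, ∀ y ∈ N.upper \ N.lower, ρ x < ρ y → y ∈ (C x).lower := by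
  classical
  let P : Set X → Prop := fun D => IsClosed D ∧ Convex ℝ D ∧ N.lower ⊆ D ∧ D ⊆ N.upper
  have href : ∀ D, P D → D ≠ N.lower → ∃ (g' : StrongDual ℝ X) (c' δ' : ℝ),
      {x ∈ D | g' x < c'}.Nonempty ∧ (SliceNode.ofSlice D g' c' δ').IsRefinement N η :=
    fun D hD hne => hN.exists_refinement hX hη hD.1 hD.2.1 hD.2.2.1 hD.2.2.2 hne
  choose! g' c' δ' hne href using href
  let M : Set X → SliceNode X := fun D => SliceNode.ofSlice D (g' D) (c' D) (δ' D)
  -- Removal stops at `N.lower`, the only fixed point of `s` in the class `P`.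
  let s : Set X → Set X := fun D => if D = N.lower then D else (M D).lower
  have hs : ∀ D, P D → P (s D) ∧ s D ⊆ D ∧ (s D = D → D = N.lower) := by
    intro D hD
    by_cases hDL : D = N.lower
    · simp only [s, if_pos hDL]
      exact ⟨hD, subset_rfl, fun _ => hDL⟩
    · simp only [s, if_neg hDL]
      have h1 := href D hD hDL
      refine ⟨⟨h1.isValid.isClosed_lower, h1.isValid.convex_lower, fun y hy => ?_,
        fun y hy => hD.2.2.2 hy.1⟩, fun y hy => hy.1, fun heq => ?_⟩
      · by_contra hcon
        exact h1.notMem_lower y ⟨hD.2.2.1 hy, hcon⟩ (g' D)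
          (by simpa [SliceNode.ofSlice] using h1.isValid.tol_pos.le) y (hN.lower_subset hy)
          (by simp) hy
      · obtain ⟨p, hp, hpc⟩ := hne D hD hDL
        rw [← heq] at hp
        exact absurd hp.2 (not_le.2 hpc)
  obtain ⟨ρ, Φ, hΦ, hmem, hlt⟩ := exists_removal_rank (K := N.upper) (P := P) (s := s)
    (fun ι F hF => ⟨hN.isClosed_upper.inter (isClosed_iInter fun i => (hF i).1),
      hN.convex_upper.inter (convex_iInter fun i => (hF i).2.1),
      Set.subset_inter hN.lower_subset (Set.subset_iInter fun i => (hF i).2.2.1),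
      Set.inter_subset_left⟩) hs
  have hΦne : ∀ x ∈ N.upper \ N.lower, Φ (ρ x) ≠ N.lower :=
    fun x hx heq => hx.2 (heq ▸ (hmem x hx).1)
  have hsΦ : ∀ x ∈ N.upper \ N.lower, s (Φ (ρ x)) = (M (Φ (ρ x))).lower :=
    fun x hx => if_neg (hΦne x hx)
  refine ⟨ρ, fun x => M (Φ (ρ x)), fun x hx => ⟨href _ (hΦ _) (hΦne x hx), ?_⟩,
    fun x y hxy => by simp only [hxy], fun x hx y hy hxy => ?_⟩
  · have := hmem x hx
    rwa [hsΦ x hx] at this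
  · have := hlt x y hy hxy
    rwa [hsΦ x hx] at this

end SliceNodes

/-! ### The limit functional and convergence of plays -/

section ConvergenceStrategy

universe u

/-- A sequence in a well-order which is eventually nonincreasing is eventually constant. -/
theorem exists_eventually_const_of_succ_le {α : Type*} [LinearOrder α] [WellFoundedLT α]
    {a : ℕ → α} {n₀ : ℕ} (ha : ∀ n ≥ n₀, a (n + 1) ≤ a n) :
    ∃ n₁ ≥ n₀, ∀ n ≥ n₁, a n = a n₁ := by
  obtain ⟨_, ⟨n₁, hn₁, rfl⟩, hmin⟩ := WellFounded.has_min (wellFounded_lt (α := α))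
    (a '' Set.Ici n₀) ⟨_, n₀, Set.self_mem_Ici, rfl⟩
  refine ⟨n₁, hn₁, fun n hn => le_antisymm ?_ (not_lt.1 (hmin _ ⟨n, ge_trans hn hn₁, rfl⟩))⟩
  induction n, hn using Nat.le_induction with
  | base => exact le_rfl
  | succ n hn ih => exact (ha n (ge_trans hn hn₁)).trans ih

/-- The functionals of a sequence of successive refinements converge. -/
theorem SliceNode.exists_limit_functional {X : Type*} [NormedAddCommGroup X] [NormedSpace ℝ X]
    {N : ℕ → SliceNode X} {η : ℕ → ℝ} (hN : ∀ k, (N (k + 1)).IsRefinement (N k) (η k)) :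
    ∃ t : StrongDual ℝ X, ∀ k, ‖t - (N k).functional‖ ≤ (N k).tol := by
  have htol : ∀ k, 0 < (N (k + 1)).tol := fun k => (hN k).isValid.tol_pos
  have hhalf : ∀ k, (N k).tol ≤ (N 0).tol / 2 ^ k := by
    intro k
    induction k with
    | zero => simp
    | succ k ih =>
      have h1 := (hN k).tol_le_half
      rw [pow_succ, ← div_div]
      linarith
  have hnested : ∀ k j, ‖(N (k + j)).functional - (N k).functional‖ + (N (k + j)).tol ≤
      (N k).tol := by
    intro k j
    induction j with
    | zero => simp
    | succ j ih =>
      have h1 := (hN (k + j)).norm_sub_add_tol_le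
      have h2 := norm_sub_le_norm_sub_add_norm_sub (N (k + (j + 1))).functional
        (N (k + j)).functional (N k).functional
      rw [← add_assoc] at h2 ⊢
      linarith
  have hcauchy : CauchySeq fun k => (N k).functional := by
    refine cauchySeq_of_le_geometric_two (C := 2 * (N 0).tol) fun k => ?_
    have h1 := (hN k).norm_sub_add_tol_le
    have h2 := htol k
    have h3 := hhalf k
    rw [dist_comm, dist_eq_norm, mul_div_cancel_left₀ _ two_ne_zero]
    linarith
  obtain ⟨t, ht⟩ := cauchySeq_tendsto_of_complete hcauchy
  -- Starting at `k + 1` matters: tolerances are known to be positive only for refinements, as `N 0`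
  -- is not assumed valid.
  refine ⟨t, fun k => le_of_tendsto (ht.sub_const _).norm (eventually_atTop.2 ⟨k + 1, ?_⟩)⟩
  intro n hn
  obtain ⟨j, rfl⟩ := Nat.exists_eq_add_of_le hn
  have h1 := hnested k (1 + j)
  have h2 := htol (k + j)
  rw [show k + 1 + j = k + (1 + j) by ring]
  rw [show k + j + 1 = k + (1 + j) by ring] at h2
  linarith

variable {X : Type u} [NormedAddCommGroup X] [NormedSpace ℝ X]

/-- The difference of two consecutive cones. -/
def SliceNode.ofCone (f : StrongDual ℝ X) (ε : ℝ) (m : ℤ) : SliceNode X where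
  upper := PointCone f ε m
  lower := PointCone f ε (m - 1)
  functional := f
  tol := ε

theorem isClosed_pointCone (f : StrongDual ℝ X) (ε m : ℝ) : IsClosed (PointCone f ε m) :=
  isClosed_le (f := fun _ => (0 : ℝ)) (g := fun x => f x - ε * ‖x‖ + m) continuous_const
    (by fun_prop)

theorem convex_pointCone (f : StrongDual ℝ X) {ε : ℝ} (hε : 0 ≤ ε) (m : ℝ) :
    Convex ℝ (PointCone f ε m) := by
  intro x hx y hy p q hp hq hpq
  simp only [PointCone, Set.mem_ofPred_eq, map_add, map_smul, smul_eq_mul] at *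
  have h1 : ‖p • x + q • y‖ ≤ p * ‖x‖ + q * ‖y‖ := by
    refine (norm_add_le _ _).trans_eq ?_
    rw [norm_smul, norm_smul, Real.norm_of_nonneg hp, Real.norm_of_nonneg hq]
  have h2 := mul_le_mul_of_nonneg_left h1 hε
  have h3 := mul_nonneg hp hx
  have h4 := mul_nonneg hq hy
  have h5 : p * m + q * m = m := by rw [← add_mul, hpq, one_mul]
  linarith

theorem SliceNode.isValid_ofCone (f : StrongDual ℝ X) {ε : ℝ} (hε : 0 < ε) (m : ℤ) :
    (SliceNode.ofCone f ε m).IsValid := by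
  refine ⟨hε, fun x hx => ?_, isClosed_pointCone _ _ _, convex_pointCone _ hε.le _,
    isClosed_pointCone _ _ _, convex_pointCone _ hε.le _, ⟨m, fun x hx => ?_⟩, fun x hx => ?_⟩
  · simp only [ofCone, PointCone, Set.mem_ofPred_eq] at *
    linarith
  · simp only [ofCone, PointCone, Set.mem_ofPred_eq] at *
    linarith
  · simp only [ofCone, PointCone, Set.mem_sdiff, Set.mem_ofPred_eq, not_le] at *
    obtain ⟨φ, hφ, hφx⟩ := exists_dual_vector'' ℝ x
    set d : ℝ := -(f x - ε * ‖x‖ + (m - 1)) with hd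
    have hd0 : 0 < d := by linarith [hx.2]
    have hx1 : 0 < ‖x‖ + 1 := by positivity
    obtain ⟨τ, hτ0, hτε, hτ⟩ : ∃ τ : ℝ, 0 < τ ∧ τ ≤ ε ∧ τ * ‖x‖ < d := by
      refine ⟨min ε (d / (‖x‖ + 1)), by positivity, min_le_left _ _, ?_⟩
      calc min ε (d / (‖x‖ + 1)) * ‖x‖ < min ε (d / (‖x‖ + 1)) * (‖x‖ + 1) := by
            gcongr
            linarith
        _ ≤ d / (‖x‖ + 1) * (‖x‖ + 1) := by gcongr; exact min_le_right _ _
        _ = d := by field_simp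
    -- With `φ` norming `x`, the functional `f - ε • φ` would separate, but at distance possibly
    -- equal to `ε`; the correction `τ` makes the distance strictly smaller and costs less than the
    -- gap `d`.
    refine ⟨f - (ε - τ) • φ, -(m - 1), ?_, ?_, fun y hy => ?_⟩
    · rw [sub_sub_cancel_left, norm_neg, norm_smul, Real.norm_of_nonneg (by linarith)]
      have := mul_le_mul_of_nonneg_left hφ (sub_nonneg.2 hτε)
      linarith
    · have hφx' : φ x = ‖x‖ := hφx
      rw [sub_apply, smul_apply, smul_eq_mul, hφx']
      linarith
    · have h1 : φ y ≤ 1 * ‖y‖ := (le_abs_self _).trans (φ.le_of_opNorm_le hφ y)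
      have h2 := mul_le_mul_of_nonneg_left h1 (sub_nonneg.2 hτε)
      have h3 : 0 ≤ τ * ‖y‖ := by positivity
      rw [sub_apply, smul_apply, smul_eq_mul]
      linarith

/-- The tactic before normalization of its values. -/
theorem HasRadonNikodymProperty.exists_convergence_tactic [CompleteSpace X]
    (hX : HasRadonNikodymProperty X) (f : StrongDual ℝ X) {ε : ℝ} (hε : 0 < ε) :
    ∃ t : X → StrongDual ℝ X, (∀ x, ‖t x - f‖ ≤ ε) ∧
      ∀ x : ℕ → X, BddBelow (Set.range fun n => f (x n) - ε * ‖x n‖) →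
        (∀ n, t (x n) (x (n + 1) - x n) ≤ 0) → ∃ l : X, Tendsto x atTop (𝓝 l) := by
  have hsplit : ∀ (k : ℕ) (N : SliceNode X), N.IsValid →
      ∃ (ρ : X → Ordinal.{u}) (C : X → SliceNode X),
        (∀ x ∈ N.upper \ N.lower,
          (C x).IsRefinement N (1 / (k + 1)) ∧ x ∈ (C x).upper \ (C x).lower) ∧
        (∀ x y, ρ x = ρ y → C x = C y) ∧
        ∀ x ∈ N.upper \ N.lower, ∀ y ∈ N.upper \ N.lower, ρ x < ρ y → y ∈ (C x).lower :=
    fun k N hN => hN.exists_rank hX Nat.one_div_pos_of_nat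
  have : Nonempty (SliceNode X) := ⟨SliceNode.ofCone f ε 0⟩
  choose! ρ C hC hρ hlt using hsplit
  let lvl : X → ℤ := fun x => ⌈ε * ‖x‖ - f x⌉
  let node : ℕ → X → SliceNode X := fun k x =>
    Nat.rec (SliceNode.ofCone f ε (lvl x)) (fun j N => C j N x) k
  have hnode : ∀ k x, (node k x).IsValid ∧ x ∈ (node k x).upper \ (node k x).lower := by
    intro k x
    induction k with
    | zero =>
      refine ⟨SliceNode.isValid_ofCone f hε _, ?_, ?_⟩
      · have := Int.le_ceil (ε * ‖x‖ - f x)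
        change 0 ≤ f x - ε * ‖x‖ + (lvl x : ℤ)
        linarith
      · intro hcon
        change 0 ≤ f x - ε * ‖x‖ + ((lvl x : ℤ) - 1) at hcon
        have := Int.ceil_lt_add_one (ε * ‖x‖ - f x)
        linarith
    | succ k ih =>
      have := hC k _ ih.1 x ih.2
      exact ⟨this.1.isValid, this.2⟩
  have href : ∀ k x, (node (k + 1) x).IsRefinement (node k x) (1 / (k + 1)) :=
    fun k x => (hC k _ (hnode k x).1 x (hnode k x).2).1
  have hlim := fun x => SliceNode.exists_limit_functional (N := fun k => node k x) (fun k => href k x)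
  choose t ht using hlim
  have hmove : ∀ k x y, t x (y - x) ≤ 0 → y ∈ (node k x).upper → y ∉ (node k x).lower :=
    fun k x y hxy hy => (href k x).notMem_lower x (hnode (k + 1) x).2 (t x) (ht x (k + 1)) y hy hxy
  refine ⟨t, fun x => ht x 0, fun x hbdd hx => ?_⟩
  -- Induction on the stage: once the node at stage `k` is constant, ranks at consecutive points are
  -- comparable, and a rise in rank would be a move into the forbidden `lower` set of stage `k + 1`.
  have hstab : ∀ k, ∃ n₀, ∀ n ≥ n₀, node k (x n) = node k (x n₀) := by
    intro k
    induction k with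
    | zero =>
      obtain ⟨b, hb⟩ := hbdd
      have hle : ∀ n, lvl (x n) ≤ ⌈-b⌉ := by
        intro n
        have h1 : b ≤ f (x n) - ε * ‖x n‖ := hb ⟨n, rfl⟩
        exact Int.ceil_mono (by linarith)
      have hmono : ∀ n, lvl (x n) ≤ lvl (x (n + 1)) := by
        intro n
        by_contra! hcon
        have h1 : ((lvl (x (n + 1)) : ℤ) : ℝ) ≤ lvl (x n) - 1 := by
          exact_mod_cast Int.le_sub_one_of_lt hcon
        have h2 := Int.le_ceil (ε * ‖x (n + 1)‖ - f (x (n + 1)))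
        change _ ≤ ((lvl (x (n + 1)) : ℤ) : ℝ) at h2
        have h3 : x (n + 1) ∈ (node 0 (x n)).lower := by
          change 0 ≤ f (x (n + 1)) - ε * ‖x (n + 1)‖ + ((lvl (x n) : ℤ) - 1)
          linarith
        exact hmove 0 _ _ (hx n) ((hnode 0 _).1.lower_subset h3) h3
      obtain ⟨n₁, -, hn₁⟩ := exists_eventually_const_of_succ_le (n₀ := 0)
        (a := fun n => (⌈-b⌉ - lvl (x n)).toNat)
        fun n _ => Int.toNat_le_toNat (sub_le_sub_left (hmono n) _)
      refine ⟨n₁, fun n hn => ?_⟩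
      have h1 := hn₁ n hn
      have h2 := hle n
      have h3 := hle n₁
      have h4 : lvl (x n) = lvl (x n₁) := by
        omega
      change SliceNode.ofCone f ε (lvl (x n)) = SliceNode.ofCone f ε (lvl (x n₁))
      rw [h4]
    | succ k ih =>
      obtain ⟨n₀, hn₀⟩ := ih
      have hmem : ∀ n ≥ n₀, x n ∈ (node k (x n₀)).upper \ (node k (x n₀)).lower :=
        fun n hn => hn₀ n hn ▸ (hnode k (x n)).2
      have hchild : ∀ n ≥ n₀, node (k + 1) (x n) = C k (node k (x n₀)) (x n) := by
        intro n hn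
        change C k (node k (x n)) (x n) = _
        rw [hn₀ n hn]
      obtain ⟨n₁, hn₁, hconst⟩ := exists_eventually_const_of_succ_le (n₀ := n₀)
        (a := fun n => ρ k (node k (x n₀)) (x n)) fun n hn => by
          by_contra! hcon
          have h1 := hlt k _ (hnode k _).1 _ (hmem n hn) _ (hmem (n + 1) (by omega)) hcon
          rw [← hchild n hn] at h1
          exact hmove (k + 1) _ _ (hx n) ((hnode (k + 1) _).1.lower_subset h1) h1
      refine ⟨n₁, fun n hn => ?_⟩
      rw [hchild n (ge_trans hn hn₁), hchild n₁ hn₁]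
      exact hρ k _ (hnode k _).1 _ _ (hconst n hn)
  refine cauchySeq_tendsto_of_complete (Metric.cauchySeq_iff'.2 fun η hη => ?_)
  obtain ⟨k, hk⟩ := exists_nat_one_div_lt hη
  obtain ⟨n₀, hn₀⟩ := hstab (k + 1)
  refine ⟨n₀, fun n hn => ((href k (x n₀)).dist_lt _ ?_ _ (hnode (k + 1) (x n₀)).2).trans hk⟩
  rw [← hn₀ n hn]
  exact (hnode (k + 1) (x n)).2

end ConvergenceStrategy

theorem theorem1p2 {X : Type*} [NormedAddCommGroup X] [NormedSpace ℝ X] [CompleteSpace X]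
    (hX : HasRadonNikodymProperty X)
    (f : StrongDual ℝ X) (hf : f ∈ Metric.sphere (0 : StrongDual ℝ X) 1)
    (ε : ℝ) (hε : ε ∈ Set.Ioo (0 : ℝ) 1) :
    ∃ t : X → StrongDual ℝ X,
      (∀ x, t x ∈ Metric.sphere (0 : StrongDual ℝ X) 1 ∩ Metric.ball f ε) ∧
      (∀ x : ℕ → X,
        BddBelow (Set.range fun n => f (x n) - ε * ‖x n‖) →
        (∀ n, t (x n) (x (n + 1) - x n) ≤ 0) →
        ∃ l : X, Tendsto x atTop (𝓝 l)) ∧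
      (∀ m : ℝ, IsWinningTactic f ε m t) := by
  obtain ⟨hε0, hε1⟩ := hε
  have hf1 : ‖f‖ = 1 := by simpa using hf
  -- Normalizing moves `t x` by at most another `ε / 4`, so the result stays within `ε / 2` of `f`.
  -- Lower boundedness with `ε` implies it with `ε / 4`, and positive scaling keeps the sign of
  -- moves.
  obtain ⟨t, htf, ht⟩ := hX.exists_convergence_tactic f (ε := ε / 4) (by positivity)
  have hnorm : ∀ x, |1 - ‖t x‖| ≤ ε / 4 := by
    intro x
    rw [← hf1, abs_sub_comm]
    exact (abs_norm_sub_norm_le _ _).trans (htf x)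
  have hpos : ∀ x, 0 < ‖t x‖ := by
    intro x
    have := (le_abs_self _).trans (hnorm x)
    linarith
  have hmem : ∀ x, ‖t x‖⁻¹ • t x ∈ Metric.sphere (0 : StrongDual ℝ X) 1 ∩ Metric.ball f ε := by
    intro x
    refine ⟨?_, ?_⟩
    · rw [mem_sphere_zero_iff_norm, norm_smul, norm_inv, norm_norm, inv_mul_cancel₀ (hpos x).ne']
    · rw [mem_ball_iff_norm]
      have h1 : ‖‖t x‖⁻¹ • t x - t x‖ = |1 - ‖t x‖| := by
        rw [show ‖t x‖⁻¹ • t x - t x = (‖t x‖⁻¹ - 1) • t x by module,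
          norm_smul, Real.norm_eq_abs]
        nth_rewrite 2 [← abs_of_pos (hpos x)]
        rw [← abs_mul, sub_mul, inv_mul_cancel₀ (hpos x).ne', one_mul]
      have h2 := norm_sub_le_norm_sub_add_norm_sub (‖t x‖⁻¹ • t x) (t x) f
      linarith [hnorm x, htf x]
  have hconv : ∀ x : ℕ → X, BddBelow (Set.range fun n => f (x n) - ε * ‖x n‖) →
      (∀ n, (‖t (x n)‖⁻¹ • t (x n)) (x (n + 1) - x n) ≤ 0) → ∃ l : X, Tendsto x atTop (𝓝 l) := by
    rintro x ⟨b, hb⟩ hx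
    refine ht x ⟨b, ?_⟩ fun n => ?_
    · rintro _ ⟨n, rfl⟩
      have h1 : b ≤ f (x n) - ε * ‖x n‖ := hb ⟨n, rfl⟩
      have h2 : 0 ≤ ε * ‖x n‖ := by positivity
      simp only
      linarith
    · have h1 := hx n
      rw [smul_apply, smul_eq_mul] at h1
      exact nonpos_of_mul_nonpos_right h1 (inv_pos.2 (hpos _))
  refine ⟨fun x => ‖t x‖⁻¹ • t x, hmem, hconv, fun m => ⟨hmem, fun x F hplay hF => ?_⟩⟩
  refine hconv x ⟨-m, ?_⟩ fun n => ?_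
  · rintro _ ⟨n, rfl⟩
    have h1 : 0 ≤ f (x n) - ε * ‖x n‖ + m := hplay.point_mem n
    simp only
    linarith
  · have h1 := hplay.rule n
    rwa [hF n] at h1
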